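/- Let $\mathscr{H}$ be a complex Hilbert space. For $0<p<\infty$ let $\mathbb{B}_p(\mathscr{H})$ be the Schatten class of all compact operators $X$ on $\mathscr{H}$ with $\sum_j s_j(X)^p<\infty$, where the $s_j(X)$ are the singular values of $X$, i.e. the eigenvalues of $|X|=(X^*X)^{1/2}$ counted with multiplicity, and put $\|X\|_p=\big(\sum_j s_j(X)^p\big)^{1/p}$. Let $n\ge 1$ and $\omega_j=\exp(2\pi i j/n)$ for $j=0,\dots,n-1$. Let $0<p<\infty$ and $A_1,\dots,A_n\in\mathbb{B}_p(\mathscr{H})$. Then $\sum_{j=1}^n\omega_{j-1}^{k-1}A_j\in\mathbb{B}_p(\mathscr{H})$ for $k=1,\dots,n$ and $\sum_{j=1}^n|A_j|^2\in\mathbb{B}_{p/2}(\mathscr{H})$. If $p\ge 2$, then \[ \sum_{k=1}^n\Big\|\sum_{j=1}^n\omega_{j-1}^{k-1}A_j\Big\|_p^p\le n^{p/2}\,\Big\|\sum_{j=1}^n|A_j|^2\Big\|_{p/2}^{p/2}. \] If $0<p\le 2$, then the reverse inequality holds: \[ n^{p/2}\,\Big\|\sum_{j=1}^n|A_j|^2\Big\|_{p/2}^{p/2}\le\sum_{k=1}^n\Big\|\sum_{j=1}^n\omega_{j-1}^{k-1}A_j\Big\|_p^p.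 \] -/

import Mathlib

noncomputable section

namespace Schatten

variable {H : Type*} [NormedAddCommGroup H] [InnerProductSpace ℂ H] [CompleteSpace H]

/-- The multiplicity of `s > 0` as a singular value of the compact operator `X`: the dimension of
the eigenspace of `|X| = (X* X)^(1/2)` for the eigenvalue `s` (finite, as `X` is compact). -/
def singularMultiplicity (X : H →L[ℂ] H) (s : ℝ) : ℕ :=
  Module.finrank ℂ
    (Module.End.eigenspace ((CFC.abs X : H →L[ℂ] H) : H →ₗ[ℂ] H) (s : ℂ))

/-- The sum `∑ⱼ sⱼ(X)^p ∈ [0, ∞]` over the nonzero singular values of a compact operator `X`,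
that is, over the nonzero eigenvalues of `|X|`, counted with multiplicity. -/
def singularSum (p : ℝ) (X : H →L[ℂ] H) : ENNReal :=
  ∑' s : {s : ℝ // 0 < s},
    (singularMultiplicity X (s : ℝ) : ENNReal) * ENNReal.ofReal ((s : ℝ) ^ p)

/-- Membership in the Schatten class `B_p(H)`, for `0 < p < ∞`. -/
def MemSchatten (p : ℝ) (X : H →L[ℂ] H) : Prop :=
  IsCompactOperator X ∧ singularSum p X < ⊤

/-- The Schatten (quasi-)norm `‖X‖_p = (∑ⱼ sⱼ(X)^p)^(1/p)` of `X ∈ B_p(H)`. -/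
def schattenNorm (p : ℝ) (X : H →L[ℂ] H) : ℝ :=
  (singularSum p X).toReal ^ (1 / p)

/-- The `n`-th root of unity `ω_j = exp(2 π i j / n)`. -/
def rootOfUnity (n j : ℕ) : ℂ :=
  Complex.exp (2 * (Real.pi : ℂ) * Complex.I * (j : ℂ) / (n : ℂ))

end Schatten

end

/-! Write `B k` for the Fourier combinations of the `A j` and `q = p / 2`. Orthogonality of
characters gives `∑ B k* B k = n ∑ |A j|²`, and `‖B k‖_p^p = tr (B k* B k)^q`. What remains is
McCarthy's inequality for positive compact `X k`: `∑ tr (X k)^q ≤ tr (∑ X k)^q` for `q ≥ 1`,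
reversed for `q ≤ 1`.

It follows from Jensen alone. Let `R = ∑ X k` have eigenvectors `e i` with eigenvalues `r i`, and `S
= X k ≤ R` have `f j` with `s j`. The weights `w i j = (s j / r i) |⟨e i, f j⟩|²` satisfy `∑ i, w i
j * r i = s j` and, because `S ≤ R`, `∑ i, w i j ≤ 1`. For `q ≥ 1` this yields `(s j)^q ≤ ∑ i, w i j
* (r i)^q`. Since `∑ j, w i j = ⟨e i, S (e i)⟩ / r i` is linear in `S`, summing over `j` and then
`k` gives `∑ (r i)^q`. -/

namespace Schatten

open scoped ENNReal InnerProductSpace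

/-! ### Jensen's inequality for subprobability weights -/

section Jensen

variable {ι : Type*}

/-- Jensen's inequality for `x ↦ x ^ q`, `1 ≤ q`, and weights of total mass at most one. -/
theorem rpow_tsum_mul_le {q : ℝ} (hq : 1 ≤ q) (w f : ι → ℝ≥0∞) (hw : ∑' i, w i ≤ 1) :
    (∑' i, w i * f i) ^ q ≤ ∑' i, w i * f i ^ q := by
  have hq0 : 0 < q := by linarith
  rw [← ENNReal.le_rpow_inv_iff hq0, ENNReal.tsum_eq_iSup_sum]
  refine iSup_le fun s => (ENNReal.inner_le_weight_mul_Lp_of_nonneg s hq w f).trans ?_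
  have h1 : (∑ i ∈ s, w i) ^ (1 - q⁻¹) ≤ 1 :=
    ENNReal.rpow_le_one ((ENNReal.sum_le_tsum s).trans hw) (by
      have := inv_le_one_of_one_le₀ hq
      linarith)
  calc _ ≤ 1 * (∑ i ∈ s, w i * f i ^ q) ^ q⁻¹ := by gcongr
    _ ≤ _ := by
      rw [one_mul]
      exact ENNReal.rpow_le_rpow (ENNReal.sum_le_tsum s) (by positivity)

/-- Jensen's inequality for `x ↦ x ^ q`, `0 < q ≤ 1`, and weights of total mass at most one. -/
theorem tsum_mul_rpow_le {q : ℝ} (hq : 0 < q) (hq1 : q ≤ 1) (w f : ι → ℝ≥0∞)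
    (hw : ∑' i, w i ≤ 1) :
    ∑' i, w i * f i ^ q ≤ (∑' i, w i * f i) ^ q := by
  -- The convex case with exponent `q⁻¹`, applied to `f ^ q`.
  have h := rpow_tsum_mul_le (one_le_inv_iff₀.2 ⟨hq, hq1⟩) w (fun i => f i ^ q) hw
  rw [ENNReal.rpow_inv_le_iff hq] at h
  simpa only [ENNReal.rpow_rpow_inv hq.ne'] using h

end Jensen

/-! ### Comparison of the eigenvalues of `S ≤ R` -/

variable {H : Type*} [NormedAddCommGroup H] [InnerProductSpace ℂ H]

theorem tsum_enorm_inner_sq {ι : Type*} (e : HilbertBasis ι ℂ H) (x : H) :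
    ∑' i, ‖⟪e i, x⟫_ℂ‖ₑ ^ 2 = ‖x‖ₑ ^ 2 := by
  have h := e.hasSum_inner_mul_inner x x
  have h2 : HasSum (fun i => ‖⟪e i, x⟫_ℂ‖ ^ 2) (‖x‖ ^ 2) := by
    have := Complex.hasSum_re h
    convert this using 1
    · ext i
      rw [← inner_conj_symm x (e i), Complex.conj_mul']
      norm_cast
    · rw [inner_self_eq_norm_sq_to_K]
      norm_cast
  have h3 := h2.tsum_eq ▸ ENNReal.ofReal_tsum_of_nonneg (fun i => by positivity) h2.summable
  simpa only [ENNReal.ofReal_pow (norm_nonneg _), ofReal_norm] using h3.symm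

/-- A Hilbert basis of eigenvectors of `T` with nonnegative eigenvalues. -/
structure EigenBasis (T : H →L[ℂ] H) (ι : Type*) where
  /-- the eigenvectors -/
  basis : HilbertBasis ι ℂ H
  /-- the eigenvalues -/
  value : ι → ℝ
  value_nonneg : ∀ i, 0 ≤ value i
  apply_basis : ∀ i, T (basis i) = (value i : ℂ) • basis i

namespace EigenBasis

variable {ι κ : Type*} {R S T : H →L[ℂ] H}

theorem tsum_value_mul_enorm_inner_sq (D : EigenBasis T ι) (hT : T.IsPositive) (x : H) :
    ∑' i, ENNReal.ofReal (D.value i) * ‖⟪D.basis i, x⟫_ℂ‖ₑ ^ 2 =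
      ENNReal.ofReal (⟪x, T x⟫_ℂ).re := by
  have h := Complex.hasSum_re (D.basis.hasSum_inner_mul_inner x (T x))
  have h2 : HasSum (fun i => D.value i * ‖⟪D.basis i, x⟫_ℂ‖ ^ 2) (⟪x, T x⟫_ℂ).re := by
    convert h using 1
    ext i
    rw [← hT.inner_left_eq_inner_right, D.apply_basis, inner_smul_left, Complex.conj_ofReal,
      mul_left_comm, ← inner_conj_symm x, Complex.conj_mul']
    norm_cast
  rw [← h2.tsum_eq, ENNReal.ofReal_tsum_of_nonneg
    (fun i => mul_nonneg (D.value_nonneg i) (by positivity)) h2.summable]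
  simp only [ENNReal.ofReal_mul (D.value_nonneg _), ENNReal.ofReal_pow (norm_nonneg _), ofReal_norm]

theorem inner_apply_basis (D : EigenBasis T ι) (i : ι) :
    ⟪D.basis i, T (D.basis i)⟫_ℂ = D.value i := by
  rw [D.apply_basis, inner_smul_right, inner_self_eq_norm_sq_to_K, D.basis.orthonormal.1]
  simp

theorem re_inner_mono (h : S ≤ R) (x : H) : (⟪x, S x⟫_ℂ).re ≤ (⟪x, R x⟫_ℂ).re := by
  have := ((ContinuousLinearMap.le_def _ _).1 h).re_inner_nonneg_right x
  simpa [inner_sub_right] using this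

theorem value_mul_enorm_inner_sq_le (E : EigenBasis S κ) (hS : S.IsPositive) (h : S ≤ R) (x : H)
    (j : κ) : ENNReal.ofReal (E.value j) * ‖⟪E.basis j, x⟫_ℂ‖ₑ ^ 2 ≤
      ENNReal.ofReal (⟪x, R x⟫_ℂ).re := by
  refine le_trans ?_ (ENNReal.ofReal_le_ofReal (re_inner_mono h x))
  rw [← E.tsum_value_mul_enorm_inner_sq hS]
  exact ENNReal.le_tsum j

/-- The weight `(s / r) |⟨e, f⟩|²` attached to an eigenvector `e` of `R` for the eigenvalue `r` and
an eigenvector `f` of `S` for the eigenvalue `s`. -/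
noncomputable def weight (D : EigenBasis R ι) (E : EigenBasis S κ) (i : ι) (j : κ) : ℝ≥0∞ :=
  ENNReal.ofReal (E.value j) * (ENNReal.ofReal (D.value i))⁻¹ * ‖⟪D.basis i, E.basis j⟫_ℂ‖ₑ ^ 2

theorem enorm_inner_comm (x y : H) : ‖⟪x, y⟫_ℂ‖ₑ = ‖⟪y, x⟫_ℂ‖ₑ := by
  rw [← ofReal_norm, ← ofReal_norm, norm_inner_symm]

theorem value_mul_enorm_inner_sq_le_value (D : EigenBasis R ι) (E : EigenBasis S κ)
    (hS : S.IsPositive) (h : S ≤ R) (i : ι) (j : κ) :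
    ENNReal.ofReal (E.value j) * ‖⟪D.basis i, E.basis j⟫_ℂ‖ₑ ^ 2 ≤ ENNReal.ofReal (D.value i) := by
  have := E.value_mul_enorm_inner_sq_le hS h (D.basis i) j
  rwa [D.inner_apply_basis, Complex.ofReal_re, enorm_inner_comm] at this

/-- If `r i = 0`, the inverse in the weight is `⊤`, but `S ≤ R` forces `s j * |⟨e i, f j⟩|² = 0`, so
the weight vanishes. -/
theorem weight_mul_value (D : EigenBasis R ι) (E : EigenBasis S κ) (hS : S.IsPositive)
    (h : S ≤ R) (i : ι) (j : κ) : D.weight E i j * ENNReal.ofReal (D.value i) =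
      ENNReal.ofReal (E.value j) * ‖⟪D.basis i, E.basis j⟫_ℂ‖ₑ ^ 2 := by
  have h1 := D.value_mul_enorm_inner_sq_le_value E hS h i j
  unfold weight
  rcases eq_or_ne (ENNReal.ofReal (D.value i)) 0 with h0 | h0
  · rw [h0] at h1 ⊢
    rw [mul_zero, nonpos_iff_eq_zero.1 h1]
  · rw [mul_right_comm, mul_assoc (ENNReal.ofReal (E.value j)), ENNReal.inv_mul_cancel h0
      ENNReal.ofReal_ne_top, mul_one]

theorem tsum_weight_mul_value (D : EigenBasis R ι) (E : EigenBasis S κ) (hS : S.IsPositive)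
    (h : S ≤ R) (j : κ) :
    ∑' i, D.weight E i j * ENNReal.ofReal (D.value i) = ENNReal.ofReal (E.value j) := by
  simp only [D.weight_mul_value E hS h, ENNReal.tsum_mul_left, tsum_enorm_inner_sq]
  rw [← ofReal_norm, E.basis.orthonormal.1]
  simp

theorem tsum_weight_right (D : EigenBasis R ι) (E : EigenBasis S κ) (hS : S.IsPositive) (i : ι) :
    ∑' j, D.weight E i j =
      (ENNReal.ofReal (D.value i))⁻¹ *
        ENNReal.ofReal (⟪D.basis i, S (D.basis i)⟫_ℂ).re := by
  rw [← E.tsum_value_mul_enorm_inner_sq hS, ← ENNReal.tsum_mul_left]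
  refine tsum_congr fun j => ?_
  rw [weight, enorm_inner_comm]
  ring

/-- Formally the sum is `s ⟨f, R⁻¹ f⟩`. Truncating `R⁻¹ f` to a finite set `F` gives `v` with `⟨f,
v⟩ = ⟨v, R v⟩ = a`; then `s |⟨f, v⟩|² ≤ ⟨v, R v⟩` reads `s a² ≤ a`. -/
theorem tsum_weight_left_le_one (D : EigenBasis R ι) (E : EigenBasis S κ) (hS : S.IsPositive)
    (h : S ≤ R) (j : κ) : ∑' i, D.weight E i j ≤ 1 := by
  rw [ENNReal.tsum_eq_iSup_sum]
  refine iSup_le fun F => ?_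
  set f := E.basis j
  set s := E.value j
  have hs : 0 ≤ s := E.value_nonneg j
  -- The real inverse sends `0` to `0`, so kernel vectors of `R` drop out of `v`.
  set c : ι → ℂ := fun i => ((D.value i)⁻¹ : ℝ) * ⟪D.basis i, f⟫_ℂ
  set a : ℝ := ∑ i ∈ F, (D.value i)⁻¹ * ‖⟪D.basis i, f⟫_ℂ‖ ^ 2
  have ha : 0 ≤ a := Finset.sum_nonneg fun i _ =>
    mul_nonneg (inv_nonneg.2 (D.value_nonneg i)) (by positivity)
  set v : H := ∑ i ∈ F, c i • D.basis i
  have hterm (i : ι) : D.weight E i j =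
      ENNReal.ofReal (s * ((D.value i)⁻¹ * ‖⟪D.basis i, f⟫_ℂ‖ ^ 2)) := by
    rw [ENNReal.ofReal_mul hs, ENNReal.ofReal_mul (inv_nonneg.2 (D.value_nonneg i)),
      ENNReal.ofReal_pow (norm_nonneg _), ofReal_norm, weight, mul_assoc]
    rcases (D.value_nonneg i).eq_or_lt with h0 | h0
    · have h1 := D.value_mul_enorm_inner_sq_le_value E hS h i j
      rw [← h0, ENNReal.ofReal_zero, nonpos_iff_eq_zero, mul_eq_zero] at h1
      rcases h1 with h1 | h1
      · rw [h1, zero_mul, zero_mul]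
      · rw [show ‖⟪D.basis i, f⟫_ℂ‖ₑ ^ 2 = 0 from h1, mul_zero, mul_zero, mul_zero, mul_zero]
    · rw [ENNReal.ofReal_inv_of_pos h0]
  have hsum : ∑ i ∈ F, D.weight E i j = ENNReal.ofReal (s * a) := by
    simp only [hterm]
    rw [← ENNReal.ofReal_sum_of_nonneg fun i _ => mul_nonneg hs
      (mul_nonneg (inv_nonneg.2 (D.value_nonneg i)) (by positivity)), ← Finset.mul_sum]
  have hfv : ⟪f, v⟫_ℂ = (a : ℂ) := by
    simp only [v, a, inner_sum, inner_smul_right, Complex.ofReal_sum, c]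
    refine Finset.sum_congr rfl fun i _ => ?_
    rw [mul_assoc, ← inner_conj_symm f, Complex.mul_conj']
    push_cast
    rfl
  have hvR : ⟪v, R v⟫_ℂ = (a : ℂ) := by
    have hR : R v = ∑ i ∈ F, (c i * D.value i) • D.basis i := by
      simp only [v, map_sum, map_smul, D.apply_basis, smul_smul]
    rw [hR, D.basis.orthonormal.inner_sum]
    simp only [a, Complex.ofReal_sum]
    refine Finset.sum_congr rfl fun i _ => ?_
    simp only [c, map_mul, Complex.conj_ofReal]
    rw [show ∀ u w x y : ℂ, u * x * (u * y * w) = u * u * w * (x * y) by intros; ring,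
      Complex.conj_mul']
    norm_cast
    rcases eq_or_ne (D.value i) 0 with h0 | h0
    · simp [h0]
    · rw [mul_assoc (D.value i)⁻¹, inv_mul_cancel₀ h0, mul_one]
  have key := E.value_mul_enorm_inner_sq_le hS h v j
  change ENNReal.ofReal s * ‖⟪f, v⟫_ℂ‖ₑ ^ 2 ≤ _ at key
  rw [hfv, hvR, Complex.ofReal_re, ← ofReal_norm, Complex.norm_real, Real.norm_of_nonneg ha,
    ← ENNReal.ofReal_pow ha, ← ENNReal.ofReal_mul hs, ENNReal.ofReal_le_ofReal_iff ha] at key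
  rw [hsum, ENNReal.ofReal_le_one]
  rcases ha.eq_or_lt with h0 | h0
  · rw [← h0]
    simp
  · refine le_of_mul_le_mul_right ?_ h0
    linarith

/-- The sum of the `q`-th powers of the eigenvalues. -/
noncomputable def powSum (D : EigenBasis T ι) (q : ℝ) : ℝ≥0∞ :=
  ∑' i, ENNReal.ofReal (D.value i) ^ q

theorem tsum_tsum_weight_mul_rpow (D : EigenBasis R ι) (E : EigenBasis S κ) (hS : S.IsPositive)
    (q : ℝ) : ∑' j, ∑' i, D.weight E i j * ENNReal.ofReal (D.value i) ^ q =
      ∑' i, (ENNReal.ofReal (D.value i))⁻¹ * ENNReal.ofReal (⟪D.basis i, S (D.basis i)⟫_ℂ).re *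
        ENNReal.ofReal (D.value i) ^ q := by
  rw [ENNReal.tsum_comm]
  simp only [ENNReal.tsum_mul_right, D.tsum_weight_right E hS]

theorem powSum_le_of_one_le (D : EigenBasis R ι) (E : EigenBasis S κ) (hS : S.IsPositive)
    (h : S ≤ R) {q : ℝ} (hq : 1 ≤ q) : E.powSum q ≤
      ∑' i, (ENNReal.ofReal (D.value i))⁻¹ * ENNReal.ofReal (⟪D.basis i, S (D.basis i)⟫_ℂ).re *
        ENNReal.ofReal (D.value i) ^ q := by
  rw [← D.tsum_tsum_weight_mul_rpow E hS]
  refine ENNReal.tsum_le_tsum fun j => ?_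
  rw [← D.tsum_weight_mul_value E hS h]
  exact rpow_tsum_mul_le hq _ _ (D.tsum_weight_left_le_one E hS h j)

theorem le_powSum_of_le_one (D : EigenBasis R ι) (E : EigenBasis S κ) (hS : S.IsPositive)
    (h : S ≤ R) {q : ℝ} (hq : 0 < q) (hq1 : q ≤ 1) :
    ∑' i, (ENNReal.ofReal (D.value i))⁻¹ * ENNReal.ofReal (⟪D.basis i, S (D.basis i)⟫_ℂ).re *
        ENNReal.ofReal (D.value i) ^ q ≤ E.powSum q := by
  rw [← D.tsum_tsum_weight_mul_rpow E hS]
  refine ENNReal.tsum_le_tsum fun j => ?_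
  rw [← D.tsum_weight_mul_value E hS h]
  exact tsum_mul_rpow_le hq hq1 _ _ (D.tsum_weight_left_le_one E hS h j)

/-- Monotonicity of the power sums of the eigenvalues. -/
theorem powSum_mono (D : EigenBasis R ι) (E : EigenBasis S κ) (hS : S.IsPositive)
    (h : S ≤ R) {q : ℝ} (hq : 0 < q) : E.powSum q ≤ D.powSum q := by
  have hj (j : κ) : ENNReal.ofReal (E.value j) ^ q ≤
      ∑' i, ‖⟪D.basis i, E.basis j⟫_ℂ‖ₑ ^ 2 * ENNReal.ofReal (D.value i) ^ q := by
    set b := ENNReal.ofReal (E.value j)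
    rcases eq_or_ne b 0 with h0 | h0
    · rw [h0, ENNReal.zero_rpow_of_pos hq]
      exact zero_le
    -- The exponent `1 + q` makes Jensen available for every `q > 0`; cancelling one factor `s j`
    -- leaves the doubly stochastic weights `|⟨e i, f j⟩|²`.
    have h1 := rpow_tsum_mul_le (q := 1 + q) (by linarith) (fun i => D.weight E i j)
      (fun i => ENNReal.ofReal (D.value i)) (D.tsum_weight_left_le_one E hS h j)
    rw [D.tsum_weight_mul_value E hS h] at h1
    simp only [ENNReal.rpow_add_of_nonneg 1 q zero_le_one hq.le, ENNReal.rpow_one,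
      ← mul_assoc, D.weight_mul_value E hS h] at h1
    simp only [mul_assoc, ENNReal.tsum_mul_left] at h1
    exact (ENNReal.mul_le_mul_iff_right h0 ENNReal.ofReal_ne_top).1 h1
  refine (ENNReal.tsum_le_tsum hj).trans ?_
  rw [ENNReal.tsum_comm]
  refine ENNReal.tsum_le_tsum fun i => ?_
  simp only [ENNReal.tsum_mul_right, enorm_inner_comm (D.basis i), tsum_enorm_inner_sq]
  rw [← ofReal_norm, D.basis.orthonormal.1]
  simp

theorem powSum_eq (D : EigenBasis T ι) (E : EigenBasis T κ) (hT : T.IsPositive) {q : ℝ}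
    (hq : 0 < q) : D.powSum q = E.powSum q :=
  le_antisymm (E.powSum_mono D hT le_rfl hq) (D.powSum_mono E hT le_rfl hq)

/-- The eigenbasis of a nonnegative multiple. -/
def smul (D : EigenBasis T ι) (c : ℝ) (hc : 0 ≤ c) : EigenBasis ((c : ℂ) • T) ι where
  basis := D.basis
  value i := c * D.value i
  value_nonneg i := mul_nonneg hc (D.value_nonneg i)
  apply_basis i := by
    rw [smul_apply, D.apply_basis, smul_smul, Complex.ofReal_mul]

theorem powSum_smul (D : EigenBasis T ι) {c : ℝ} (hc : 0 ≤ c) {q : ℝ} (hq : 0 < q) :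
    (D.smul c hc).powSum q = ENNReal.ofReal c ^ q * D.powSum q := by
  simp only [powSum, smul, ENNReal.ofReal_mul hc, ENNReal.mul_rpow_of_nonneg _ _ hq.le,
    ENNReal.tsum_mul_left]

/-! ### McCarthy's inequalities for finite sums of positive operators -/

section Sum

variable {m : Type*} {X : m → H →L[ℂ] H} {κ : m → Type*}

theorem isPositive_sum (hX : ∀ k, (X k).IsPositive) (s : Finset m) :
    (∑ k ∈ s, X k).IsPositive := by
  classical
  induction s using Finset.induction_on with
  | empty => simp
  | insert a s ha ih => rw [Finset.sum_insert ha]; exact (hX a).add ih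

variable [Fintype m]

theorem le_sum_of_isPositive (hX : ∀ k, (X k).IsPositive) (k : m) : X k ≤ ∑ l, X l := by
  classical
  rw [ContinuousLinearMap.le_def, ← Finset.add_sum_erase _ _ (Finset.mem_univ k),
    add_sub_cancel_left]
  exact isPositive_sum hX _

theorem sum_ofReal_re_inner (D : EigenBasis (∑ k, X k) ι) (hX : ∀ k, (X k).IsPositive) (i : ι) :
    ∑ k, ENNReal.ofReal (⟪D.basis i, X k (D.basis i)⟫_ℂ).re = ENNReal.ofReal (D.value i) := by
  rw [← ENNReal.ofReal_sum_of_nonneg (f := fun k => (⟪D.basis i, X k (D.basis i)⟫_ℂ).re)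
      fun k _ => (hX k).re_inner_nonneg_right _,
    ← Complex.re_sum, ← inner_sum, ← sum_apply, D.inner_apply_basis,
    Complex.ofReal_re]

theorem sum_tsum_eq_powSum (D : EigenBasis (∑ k, X k) ι) (hX : ∀ k, (X k).IsPositive) {q : ℝ}
    (hq : 0 < q) :
    ∑ k, ∑' i, (ENNReal.ofReal (D.value i))⁻¹ *
      ENNReal.ofReal (⟪D.basis i, X k (D.basis i)⟫_ℂ).re * ENNReal.ofReal (D.value i) ^ q =
      D.powSum q := by
  rw [← Summable.tsum_finsetSum fun _ _ => ENNReal.summable]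
  refine tsum_congr fun i => ?_
  rw [← Finset.sum_mul, ← Finset.mul_sum, D.sum_ofReal_re_inner hX]
  rcases eq_or_ne (ENNReal.ofReal (D.value i)) 0 with h0 | h0
  · rw [h0, ENNReal.zero_rpow_of_pos hq, mul_zero]
  · rw [ENNReal.inv_mul_cancel h0 ENNReal.ofReal_ne_top, one_mul]

/-- McCarthy's inequality for exponents `1 ≤ q`. -/
theorem sum_powSum_le (D : EigenBasis (∑ k, X k) ι) (E : ∀ k, EigenBasis (X k) (κ k))
    (hX : ∀ k, (X k).IsPositive) {q : ℝ} (hq : 1 ≤ q) :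
    ∑ k, (E k).powSum q ≤ D.powSum q := by
  rw [← D.sum_tsum_eq_powSum hX (by linarith)]
  exact Finset.sum_le_sum fun k _ =>
    D.powSum_le_of_one_le (E k) (hX k) (le_sum_of_isPositive hX k) hq

/-- McCarthy's inequality for exponents `0 < q ≤ 1`. -/
theorem powSum_le_sum (D : EigenBasis (∑ k, X k) ι) (E : ∀ k, EigenBasis (X k) (κ k))
    (hX : ∀ k, (X k).IsPositive) {q : ℝ} (hq : 0 < q) (hq1 : q ≤ 1) :
    D.powSum q ≤ ∑ k, (E k).powSum q := by
  rw [← D.sum_tsum_eq_powSum hX hq]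
  exact Finset.sum_le_sum fun k _ =>
    D.le_powSum_of_le_one (E k) (hX k) (le_sum_of_isPositive hX k) hq hq1

/-- Each diagonal entry averages the eigenvalues with weights `|⟨f j, e i⟩|²`, which sum to one over
`j` and over `i`. -/
theorem tsum_rpow_re_inner_le (e : HilbertBasis ι ℂ H) {κ : Type*} (E : EigenBasis T κ)
    (hT : T.IsPositive) {q : ℝ} (hq : 1 ≤ q) :
    ∑' i, ENNReal.ofReal (⟪e i, T (e i)⟫_ℂ).re ^ q ≤ E.powSum q := by
  have hi (i : ι) : ENNReal.ofReal (⟪e i, T (e i)⟫_ℂ).re ^ q ≤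
      ∑' j, ‖⟪E.basis j, e i⟫_ℂ‖ₑ ^ 2 * ENNReal.ofReal (E.value j) ^ q := by
    rw [← E.tsum_value_mul_enorm_inner_sq hT]
    simp only [mul_comm (ENNReal.ofReal (E.value _))]
    refine rpow_tsum_mul_le hq _ _ ?_
    rw [tsum_enorm_inner_sq, ← ofReal_norm, e.orthonormal.1]
    simp
  refine (ENNReal.tsum_le_tsum hi).trans ?_
  rw [ENNReal.tsum_comm]
  refine ENNReal.tsum_le_tsum fun j => ?_
  simp only [ENNReal.tsum_mul_right, enorm_inner_comm (E.basis j), tsum_enorm_inner_sq]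
  rw [← ofReal_norm, E.basis.orthonormal.1]
  simp

theorem powSum_sum_lt_top (D : EigenBasis (∑ k, X k) ι) (E : ∀ k, EigenBasis (X k) (κ k))
    (hX : ∀ k, (X k).IsPositive) {q : ℝ} (hq : 0 < q) (hE : ∀ k, (E k).powSum q < ⊤) :
    D.powSum q < ⊤ := by
  rcases le_total q 1 with hq1 | hq1
  · exact (D.powSum_le_sum E hX hq hq1).trans_lt (ENNReal.sum_lt_top.2 fun k _ => hE k)
  -- For `q ≥ 1` McCarthy's inequality points the wrong way for finiteness; the power mean
  -- inequality on diagonal entries replaces it.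
  have hi (i : ι) : ENNReal.ofReal (D.value i) ^ q ≤ (Fintype.card m : ℝ≥0∞) ^ (q - 1) *
      ∑ k, ENNReal.ofReal (⟪D.basis i, X k (D.basis i)⟫_ℂ).re ^ q := by
    rw [← D.sum_ofReal_re_inner hX]
    exact ENNReal.rpow_sum_le_const_mul_sum_rpow _ _ hq1
  refine (ENNReal.tsum_le_tsum hi).trans_lt ?_
  rw [ENNReal.tsum_mul_left, Summable.tsum_finsetSum fun _ _ => ENNReal.summable]
  refine ENNReal.mul_lt_top (ENNReal.rpow_lt_top_of_nonneg (by linarith)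
    (ENNReal.natCast_ne_top _)) (ENNReal.sum_lt_top.2 fun k _ => ?_)
  exact (tsum_rpow_re_inner_le D.basis (E k) (hX k) hq1).trans_lt (hE k)

end Sum

end EigenBasis

/-! ### Spectral theorem and singular values -/

section Spectral

universe u

variable {H : Type u} [NormedAddCommGroup H] [InnerProductSpace ℂ H]

/-- The sum of the `q`-th powers of the positive eigenvalues of `T`, with multiplicity. -/
noncomputable def eigenSum (q : ℝ) (T : H →L[ℂ] H) : ℝ≥0∞ :=
  ∑' s : {s : ℝ // 0 < s},
    (Module.finrank ℂ (Module.End.eigenspace (T : H →ₗ[ℂ] H) ((s : ℝ) : ℂ)) : ℝ≥0∞) *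
      ENNReal.ofReal ((s : ℝ) ^ q)

theorem eigenspace_eq_bot_of_not_nonneg {T : H →L[ℂ] H} (hT : T.IsPositive) {μ : ℂ}
    (h : ¬ ∃ s : ℝ, 0 ≤ s ∧ (s : ℂ) = μ) :
    Module.End.eigenspace (T : H →ₗ[ℂ] H) μ = ⊥ := by
  by_contra hne
  have hμ : Module.End.HasEigenvalue (T : H →ₗ[ℂ] H) μ := Module.End.hasEigenvalue_iff.2 hne
  have hre : ((μ.re : ℝ) : ℂ) = μ := Complex.conj_eq_iff_re.1
    (LinearMap.IsSymmetric.conj_eigenvalue_eq_self hT.isSymmetric hμ)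
  refine h ⟨μ.re, ?_, hre⟩
  rw [← hre] at hμ
  exact eigenvalue_nonneg_of_nonneg hμ fun x => hT.re_inner_nonneg_right x

theorem isCompactOperator_sum {m : Type*} {X : m → H →L[ℂ] H} (s : Finset m)
    (hc : ∀ k, IsCompactOperator (X k)) : IsCompactOperator (∑ k ∈ s, X k : H →L[ℂ] H) :=
  Submodule.sum_mem (compactOperator (RingHom.id ℂ) H H) fun k _ => hc k

variable [CompleteSpace H]

/-- The spectral theorem for positive compact operators. -/
theorem exists_eigenBasis {T : H →L[ℂ] H} (hT : T.IsPositive) (hc : IsCompactOperator T) :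
    ∃ (ι : Type u) (D : EigenBasis T ι), ∀ q : ℝ, 0 < q → D.powSum q = eigenSum q T := by
  classical
  -- The value `0` is included: the kernel is needed to complete the basis, and contributes `0 ^ q =
  -- 0` to the power sum.
  let V (s : {s : ℝ // 0 ≤ s}) : Submodule ℂ H :=
    Module.End.eigenspace (T : H →ₗ[ℂ] H) ((s : ℝ) : ℂ)
  have hV (s) : CompleteSpace (V s) := by
    have : IsClosed (V s : Set H) := by
      have h : (V s : Set H) = {x | T x = ((s : ℝ) : ℂ) • x} := by
        ext x
        simp [V]
      rw [h]
      exact isClosed_eq T.continuous (by fun_prop)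
    exact this.completeSpace_coe
  choose w b hb using fun s => exists_hilbertBasis ℂ (V s)
  have hfam : OrthogonalFamily ℂ (fun s => V s) fun s => (V s).subtypeₗᵢ :=
    (LinearMap.IsSymmetric.orthogonalFamily_eigenspaces hT.isSymmetric).comp
      (γ := {s : ℝ // 0 ≤ s}) (f := fun s => ((s : ℝ) : ℂ))
      (Complex.ofReal_injective.comp Subtype.val_injective)
  have hortho : Orthonormal ℂ fun a : Σ s, w s => (b a.1 a.2 : H) :=
    hfam.orthonormal_sigma_orthonormal fun s => (b s).orthonormal
  have hle (s) : V s ≤ (Submodule.span ℂ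
      (Set.range fun a : Σ s, w s => (b a.1 a.2 : H))).topologicalClosure := by
    intro x hx
    have h1 := ((b s).hasSum_repr ⟨x, hx⟩).mapL (V s).subtypeL
    refine isClosed_closure.mem_of_tendsto h1 (Filter.Eventually.of_forall fun F => ?_)
    refine subset_closure (Submodule.sum_mem _ fun i _ => ?_)
    simp only [map_smul]
    exact Submodule.smul_mem _ _ (Submodule.subset_span ⟨⟨s, i⟩, rfl⟩)
  have hbot : (Submodule.span ℂ (Set.range fun a : Σ s, w s => (b a.1 a.2 : H)))ᗮ = ⊥ := by
    rw [← Submodule.orthogonal_closure, eq_bot_iff,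
      ← ContinuousLinearMap.orthogonalComplement_iSup_eigenspaces_eq_bot hc hT.isSymmetric]
    refine Submodule.orthogonal_le (iSup_le fun μ => ?_)
    by_cases h : ∃ s : ℝ, 0 ≤ s ∧ (s : ℂ) = μ
    · obtain ⟨s, hs, rfl⟩ := h
      exact hle ⟨s, hs⟩
    · rw [eigenspace_eq_bot_of_not_nonneg hT h]
      exact bot_le
  refine ⟨Σ s, w s, ⟨HilbertBasis.mkOfOrthogonalEqBot hortho hbot, fun a => a.1.1,
    fun a => a.1.2, fun a => ?_⟩, fun q hq => ?_⟩
  · rw [HilbertBasis.coe_mkOfOrthogonalEqBot]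
    exact Module.End.mem_eigenspace_iff.1 (b a.1 a.2).2
  · have hcard (s : {s : ℝ // 0 < s}) : ∑' _ : w ⟨s, s.2.le⟩, ENNReal.ofReal (s : ℝ) ^ q =
        (Module.finrank ℂ (Module.End.eigenspace (T : H →ₗ[ℂ] H) ((s : ℝ) : ℂ)) : ℝ≥0∞) *
          ENNReal.ofReal ((s : ℝ) ^ q) := by
      have : FiniteDimensional ℂ (V ⟨s, s.2.le⟩) :=
        ContinuousLinearMap.finite_dimensional_eigenspace hc _
          (Complex.ofReal_ne_zero.2 s.2.ne')
      have : Finite (w ⟨s, s.2.le⟩) :=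
        (b ⟨s, s.2.le⟩).orthonormal.linearIndependent.finite
      have : Fintype (w ⟨s, s.2.le⟩) := Fintype.ofFinite _
      rw [tsum_fintype, Finset.sum_const, nsmul_eq_mul, Finset.card_univ,
        ENNReal.ofReal_rpow_of_pos s.2]
      congr 2
      exact (Module.finrank_eq_card_basis (b ⟨s, s.2.le⟩).toOrthonormalBasis.toBasis).symm
    simp only [EigenBasis.powSum, eigenSum]
    rw [ENNReal.tsum_sigma (f := fun (s : {s : ℝ // 0 ≤ s}) (_ : w s) =>
      ENNReal.ofReal (s : ℝ) ^ q)]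
    simp only [← hcard]
    let g : {s : ℝ // 0 < s} → {s : ℝ // 0 ≤ s} := fun s => ⟨s, s.2.le⟩
    have hg : Function.Injective g := fun s t h => Subtype.ext (congrArg (fun u => u.1) h)
    refine (hg.tsum_eq (f := fun s : {s : ℝ // 0 ≤ s} =>
      ∑' _ : w s, ENNReal.ofReal (s : ℝ) ^ q) fun s hs => ?_).symm
    rcases s.2.eq_or_lt with h0 | h0
    · refine absurd ?_ hs
      simp [← h0, ENNReal.zero_rpow_of_pos hq]
    · exact ⟨⟨s, h0⟩, rfl⟩

theorem eigenSum_smul {T : H →L[ℂ] H} (hT : T.IsPositive) (hc : IsCompactOperator T) {c : ℝ}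
    (h : 0 ≤ c) {q : ℝ} (hq : 0 < q) :
    eigenSum q ((c : ℂ) • T) = ENNReal.ofReal c ^ q * eigenSum q T := by
  obtain ⟨ι, D, hD⟩ := exists_eigenBasis hT hc
  have hcT : ((c : ℂ) • T).IsPositive := hT.smul_of_nonneg (by exact_mod_cast h)
  obtain ⟨κ, E, hE⟩ := exists_eigenBasis hcT (hc.smul (c : ℂ))
  rw [← hE q hq, ← hD q hq, ← D.powSum_smul h hq, E.powSum_eq _ hcT hq]

theorem eigenSum_mono {S T : H →L[ℂ] H} (hS : S.IsPositive) (hSc : IsCompactOperator S)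
    (hT : T.IsPositive) (hTc : IsCompactOperator T) (h : S ≤ T) {q : ℝ} (hq : 0 < q) :
    eigenSum q S ≤ eigenSum q T := by
  obtain ⟨ι, D, hD⟩ := exists_eigenBasis hT hTc
  obtain ⟨κ, E, hE⟩ := exists_eigenBasis hS hSc
  rw [← hE q hq, ← hD q hq]
  exact D.powSum_mono E hS h hq

section Sum

variable {m : Type*} [Fintype m] {X : m → H →L[ℂ] H}

theorem sum_eigenSum_le (hX : ∀ k, (X k).IsPositive) (hc : ∀ k, IsCompactOperator (X k)) {q : ℝ}
    (hq : 1 ≤ q) : ∑ k, eigenSum q (X k) ≤ eigenSum q (∑ k, X k) := by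
  obtain ⟨ι, D, hD⟩ := exists_eigenBasis (EigenBasis.isPositive_sum hX Finset.univ)
    (isCompactOperator_sum _ hc)
  choose κ E hE using fun k => exists_eigenBasis (hX k) (hc k)
  have hq0 : 0 < q := by linarith
  simpa only [hE _ q hq0, hD q hq0] using D.sum_powSum_le E hX hq

theorem eigenSum_le_sum (hX : ∀ k, (X k).IsPositive) (hc : ∀ k, IsCompactOperator (X k)) {q : ℝ}
    (hq : 0 < q) (hq1 : q ≤ 1) : eigenSum q (∑ k, X k) ≤ ∑ k, eigenSum q (X k) := by
  obtain ⟨ι, D, hD⟩ := exists_eigenBasis (EigenBasis.isPositive_sum hX Finset.univ)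
    (isCompactOperator_sum _ hc)
  choose κ E hE using fun k => exists_eigenBasis (hX k) (hc k)
  simpa only [hE _ q hq, hD q hq] using D.powSum_le_sum E hX hq hq1

theorem eigenSum_sum_lt_top (hX : ∀ k, (X k).IsPositive) (hc : ∀ k, IsCompactOperator (X k))
    {q : ℝ} (hq : 0 < q) (h : ∀ k, eigenSum q (X k) < ⊤) : eigenSum q (∑ k, X k) < ⊤ := by
  obtain ⟨ι, D, hD⟩ := exists_eigenBasis (EigenBasis.isPositive_sum hX Finset.univ)
    (isCompactOperator_sum _ hc)
  choose κ E hE using fun k => exists_eigenBasis (hX k) (hc k)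
  rw [← hD q hq]
  exact D.powSum_sum_lt_top E hX hq fun k => by rw [hE k q hq]; exact h k

end Sum

theorem singularSum_eq_eigenSum_of_nonneg {T : H →L[ℂ] H} (hT : 0 ≤ T) (q : ℝ) :
    singularSum q T = eigenSum q T := by
  simp only [singularSum, singularMultiplicity, eigenSum]
  rw [CFC.abs_of_nonneg T hT]

/-- `|X|² - s² = (|X| + s)(|X| - s)`, and `|X| + s` is injective because a positive operator has no
eigenvalue `-s < 0`. -/
theorem eigenspace_abs (X : H →L[ℂ] H) {s : ℝ} (hs : 0 < s) :
    Module.End.eigenspace ((CFC.abs X : H →L[ℂ] H) : H →ₗ[ℂ] H) (s : ℂ) =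
      Module.End.eigenspace ((star X * X : H →L[ℂ] H) : H →ₗ[ℂ] H) ((s ^ 2 : ℝ) : ℂ) := by
  have habs : (CFC.abs X).IsPositive :=
    (ContinuousLinearMap.nonneg_iff_isPositive _).1 (CFC.abs_nonneg X)
  ext x
  simp only [Module.End.mem_eigenspace_iff, ContinuousLinearMap.coe_coe, ← CFC.abs_mul_abs,
    mul_apply_eq_comp]
  constructor
  · intro h
    rw [h, map_smul, h, smul_smul]
    push_cast
    ring_nf
  · intro h
    have hbot := eigenspace_eq_bot_of_not_nonneg habs (μ := ((-s : ℝ) : ℂ)) (by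
      rintro ⟨t, ht, hts⟩
      have := Complex.ofReal_injective hts
      linarith)
    have hmem : CFC.abs X x - (s : ℂ) • x ∈
        Module.End.eigenspace ((CFC.abs X : H →L[ℂ] H) : H →ₗ[ℂ] H) ((-s : ℝ) : ℂ) := by
      rw [Module.End.mem_eigenspace_iff, ContinuousLinearMap.coe_coe, map_sub, map_smul, h]
      push_cast
      module
    rw [hbot, Submodule.mem_bot, sub_eq_zero] at hmem
    exact hmem

theorem singularSum_eq_eigenSum (X : H →L[ℂ] H) (p : ℝ) :
    singularSum p X = eigenSum (p / 2) (star X * X) := by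
  let φ : {s : ℝ // 0 < s} ≃ {s : ℝ // 0 < s} :=
    { toFun s := ⟨s.1 ^ 2, pow_pos s.2 2⟩
      invFun s := ⟨√s.1, Real.sqrt_pos.2 s.2⟩
      left_inv s := Subtype.ext (Real.sqrt_sq s.2.le)
      right_inv s := Subtype.ext (Real.sq_sqrt s.2.le) }
  rw [eigenSum, ← φ.tsum_eq]
  refine tsum_congr fun s => ?_
  rw [singularMultiplicity, eigenspace_abs X s.2]
  congr 2
  change _ = ((s : ℝ) ^ 2) ^ (p / 2)
  rw [← Real.rpow_natCast, ← Real.rpow_mul s.2.le]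
  congr 1
  push_cast
  ring

theorem schattenNorm_rpow {p : ℝ} (hp : 0 < p) (X : H →L[ℂ] H) :
    schattenNorm p X ^ p = (singularSum p X).toReal := by
  rw [schattenNorm, ← Real.rpow_mul ENNReal.toReal_nonneg, one_div, inv_mul_cancel₀ hp.ne',
    Real.rpow_one]

theorem isPositive_star_mul_self (X : H →L[ℂ] H) : (star X * X).IsPositive :=
  (ContinuousLinearMap.nonneg_iff_isPositive _).1 (star_mul_self_nonneg X)

theorem isCompactOperator_star_mul_self {X : H →L[ℂ] H} (hX : IsCompactOperator X) :
    IsCompactOperator (star X * X : H →L[ℂ] H) :=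
  hX.clm_comp (star X)

end Spectral

/-! ### Discrete Fourier transform -/

section Fourier

/-- A geometric sum whose ratio `z = ζ ^ (l - j)` is an `n`-th root of unity, equal to `1` only when
`j = l`. -/
theorem sum_conj_rootOfUnity_mul {n : ℕ} (j l : Fin n) :
    ∑ k : Fin n, star (rootOfUnity n j ^ (k : ℕ)) * rootOfUnity n l ^ (k : ℕ) =
      if j = l then (n : ℂ) else 0 := by
  have hn : n ≠ 0 := j.pos.ne'
  set ζ := Complex.exp (2 * Real.pi * Complex.I / n)
  have hζ : IsPrimitiveRoot ζ n := Complex.isPrimitiveRoot_exp n hn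
  have hroot (i : Fin n) : rootOfUnity n i = ζ ^ (i : ℕ) := by
    rw [rootOfUnity, ← Complex.exp_nat_mul]
    congr 1
    ring
  have hconj : star ζ * ζ = 1 := by
    rw [Complex.star_def, Complex.conj_mul', hζ.norm'_eq_one hn]
    simp
  set z := star (ζ ^ (j : ℕ)) * ζ ^ (l : ℕ)
  have hterm (k : Fin n) :
      star (rootOfUnity n j ^ (k : ℕ)) * rootOfUnity n l ^ (k : ℕ) = z ^ (k : ℕ) := by
    rw [hroot, hroot, star_pow, ← mul_pow]
  have hjj : star (ζ ^ (j : ℕ)) * ζ ^ (j : ℕ) = 1 := by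
    rw [star_pow, ← mul_pow, hconj, one_pow]
  simp only [hterm]
  split_ifs with h
  · subst h
    simp [z, hjj]
  · rw [Fin.sum_univ_eq_sum_range (fun k => z ^ k)]
    have hz1 : z ≠ 1 := fun hz => h (Fin.ext (hζ.pow_inj j.2 l.2
      (mul_left_cancel₀ (left_ne_zero_of_mul_eq_one hjj) (hjj.trans hz.symm))))
    have hzn : z ^ n = 1 := by
      rw [mul_pow, ← star_pow, pow_right_comm, pow_right_comm ζ l, hζ.pow_eq_one, one_pow,
        one_pow, star_one, one_mul]
    rw [geom_sum_eq hz1, hzn, sub_self, zero_div]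

/-- The parallelogram law for the discrete Fourier transform. -/
theorem sum_star_mul_self_fourier {A : Type*} [Ring A] [StarRing A] [Algebra ℂ A]
    [StarModule ℂ A] {n : ℕ} (a : Fin n → A) :
    ∑ k : Fin n, star (∑ j : Fin n, rootOfUnity n j ^ (k : ℕ) • a j) *
        (∑ j : Fin n, rootOfUnity n j ^ (k : ℕ) • a j) =
      (n : ℂ) • ∑ j, star (a j) * a j := by
  simp only [star_sum, star_smul, Finset.sum_mul_sum, smul_mul_smul_comm]
  rw [Finset.sum_comm, Finset.smul_sum]
  refine Finset.sum_congr rfl fun j _ => ?_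
  rw [Finset.sum_comm]
  simp only [← Finset.sum_smul, sum_conj_rootOfUnity_mul]
  simp

end Fourier

end Schatten

theorem mainTheorem12 {H : Type*} [NormedAddCommGroup H] [InnerProductSpace ℂ H]
    [CompleteSpace H] (n : ℕ) (p : ℝ) (hp : 0 < p) (A : Fin n → (H →L[ℂ] H))
    (hA : ∀ j, Schatten.MemSchatten p (A j)) :
    (∀ k : Fin n,
      Schatten.MemSchatten p
        (∑ j : Fin n, (Schatten.rootOfUnity n (j : ℕ) ^ (k : ℕ)) • A j)) ∧
    Schatten.MemSchatten (p / 2) (∑ j : Fin n, CFC.abs (A j) ^ 2) ∧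
    (2 ≤ p →
      ∑ k : Fin n,
          Schatten.schattenNorm p
            (∑ j : Fin n, (Schatten.rootOfUnity n (j : ℕ) ^ (k : ℕ)) • A j) ^ p ≤
        (n : ℝ) ^ (p / 2) *
          Schatten.schattenNorm (p / 2) (∑ j : Fin n, CFC.abs (A j) ^ 2) ^ (p / 2)) ∧
    (p ≤ 2 →
      (n : ℝ) ^ (p / 2) *
          Schatten.schattenNorm (p / 2) (∑ j : Fin n, CFC.abs (A j) ^ 2) ^ (p / 2) ≤
        ∑ k : Fin n,
          Schatten.schattenNorm p
            (∑ j : Fin n, (Schatten.rootOfUnity n (j : ℕ) ^ (k : ℕ)) • A j) ^ p) := by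
  have hq : 0 < p / 2 := by positivity
  simp only [CFC.abs_sq, Schatten.MemSchatten, Schatten.schattenNorm_rpow hp,
    Schatten.schattenNorm_rpow hq]
  set P : H →L[ℂ] H := ∑ j, star (A j) * A j
  set B : Fin n → (H →L[ℂ] H) := fun k =>
    ∑ j : Fin n, (Schatten.rootOfUnity n (j : ℕ) ^ (k : ℕ)) • A j
  have hAp j := Schatten.isPositive_star_mul_self (A j)
  have hAc j := Schatten.isCompactOperator_star_mul_self (hA j).1
  have hP : P.IsPositive := Schatten.EigenBasis.isPositive_sum hAp _
  have hPc : IsCompactOperator P := Schatten.isCompactOperator_sum _ hAc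
  have hBc (k) : IsCompactOperator (B k) :=
    Schatten.isCompactOperator_sum _ fun j => (hA j).1.smul _
  have hBp k := Schatten.isPositive_star_mul_self (B k)
  have hBsc k := Schatten.isCompactOperator_star_mul_self (hBc k)
  have hsum : ∑ k, star (B k) * B k = ((n : ℝ) : ℂ) • P := by
    rw [Complex.ofReal_natCast]
    exact Schatten.sum_star_mul_self_fourier A
  have hPsum : Schatten.singularSum (p / 2) P = Schatten.eigenSum (p / 2) P :=
    Schatten.singularSum_eq_eigenSum_of_nonneg
      ((ContinuousLinearMap.nonneg_iff_isPositive _).2 hP) _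
  have hPtop : Schatten.eigenSum (p / 2) P < ⊤ :=
    Schatten.eigenSum_sum_lt_top hAp hAc hq fun j => by
      rw [← Schatten.singularSum_eq_eigenSum]
      exact (hA j).2
  have hsmul := Schatten.eigenSum_smul hP hPc n.cast_nonneg hq
  have hsmulTop : Schatten.eigenSum (p / 2) (((n : ℝ) : ℂ) • P) < ⊤ := by
    rw [hsmul]
    exact ENNReal.mul_lt_top (ENNReal.rpow_lt_top_of_nonneg hq.le ENNReal.ofReal_ne_top) hPtop
  -- `B k* B k ≤ n P`, so monotonicity of the eigenvalue sums gives finiteness for every `p > 0`.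
  have hBtop (k) : Schatten.singularSum p (B k) < ⊤ := by
    rw [Schatten.singularSum_eq_eigenSum]
    refine (Schatten.eigenSum_mono (hBp k) (hBsc k)
      (Schatten.EigenBasis.isPositive_sum hBp Finset.univ)
      (Schatten.isCompactOperator_sum _ hBsc)
      (Schatten.EigenBasis.le_sum_of_isPositive hBp k) hq).trans_lt ?_
    rwa [hsum]
  have hleft : ∑ k, (Schatten.singularSum p (B k)).toReal =
      (∑ k, Schatten.eigenSum (p / 2) (star (B k) * B k)).toReal := by
    rw [← ENNReal.toReal_sum fun k _ => (hBtop k).ne]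
    simp only [Schatten.singularSum_eq_eigenSum]
  have hright : (n : ℝ) ^ (p / 2) * (Schatten.singularSum (p / 2) P).toReal =
      (Schatten.eigenSum (p / 2) (∑ k, star (B k) * B k)).toReal := by
    rw [hsum, hsmul, hPsum, ENNReal.toReal_mul, ← ENNReal.toReal_rpow,
      ENNReal.toReal_ofReal n.cast_nonneg]
  refine ⟨fun k => ⟨hBc k, hBtop k⟩, ⟨hPc, hPsum ▸ hPtop⟩, fun h => ?_, fun h => ?_⟩
  · rw [hright]
    -- `toReal` sends `⊤` to `0`, so it is monotone only below a finite bound.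
    refine hleft.trans_le (ENNReal.toReal_mono ?_
      (Schatten.sum_eigenSum_le hBp hBsc (by linarith)))
    rw [hsum]
    exact hsmulTop.ne
  · rw [hright]
    refine (ENNReal.toReal_mono ?_
      (Schatten.eigenSum_le_sum hBp hBsc hq (by linarith))).trans_eq hleft.symm
    refine (ENNReal.sum_lt_top.2 fun k _ => ?_).ne
    rw [← Schatten.singularSum_eq_eigenSum]
    exact hBtop k
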